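/- Let $n, N$ be integers with $n\ge 1$ and $N\ge n+1$, let $p\ge 1$ be a real number with $p\ne n$, let $\alpha_1,\dots,\alpha_N>0$, and let $u_1,\dots,u_N\in S^{n-1}\subset\mathbb{R}^n$ be unit vectors that are not all contained in a closed hemisphere $\{v\in S^{n-1}: v\cdot w\ge 0\}$, $w\in S^{n-1}$. When $p=1$, assume in addition that $\sum_{k=1}^N\alpha_k u_k=0$. Then there exists a polytope $P_0$ in $\mathbb{R}^n$ (the convex hull of finitely many points, with positive $n$-dimensional volume) that contains the origin in its interior and satisfies $$S_p(P_0,\cdot)=\sum_{k=1}^N\alpha_k\,\delta_{u_k}.$$ Here $\delta_{u}$ is the unit point mass at $u$ and, for a convex body $K$ containing the origin in its interior, $S_p(K,\cdot)$ is the $L_p$ surface area measure of $K$, the Borel measure on $S^{n-1}$ given by $$S_p(K,\omega)=\int_{\nu_K^{-1}(\omega)}(x\cdot\nu_K(x))^{1-p}\,d\mathcal{H}^{n-1}(x),$$ where $\mathcal{H}^{n-1}$ is $(n-1)$-dimensional Hausdorff measure and $\nu_K:\partial'K\to S^{n-1}$ is the Gauss map, defined on the set $\partial'K$ of boundary points of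 $K$ with a unique outer unit normal. -/

import Mathlib

open MeasureTheory

open scoped ENNReal

noncomputable section

namespace LpMinkowski

/-- The unit sphere `S^{n-1}` of `ℝⁿ`, with its Borel σ-algebra. -/
abbrev UnitSphere (n : ℕ) : Type := Metric.sphere (0 : EuclideanSpace ℝ (Fin n)) 1

/-- A polytope in `ℝⁿ`: the convex hull of a finite set of points, of positive `n`-dimensional
volume. -/
def IsPolytope {n : ℕ} (P : Set (EuclideanSpace ℝ (Fin n))) : Prop :=
  (∃ s : Finset (EuclideanSpace ℝ (Fin n)),
    P = convexHull ℝ (s : Set (EuclideanSpace ℝ (Fin n)))) ∧ 0 < volume P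

/-- `u` is an outer unit normal of `K` at `x`: `x · u = max {y · u : y ∈ K}`. -/
def IsOuterNormal {n : ℕ} (K : Set (EuclideanSpace ℝ (Fin n)))
    (x : EuclideanSpace ℝ (Fin n)) (u : UnitSphere n) : Prop :=
  ∀ y ∈ K, inner ℝ y (u : EuclideanSpace ℝ (Fin n)) ≤ inner ℝ x (u : EuclideanSpace ℝ (Fin n))

/-- The set `∂'K` of boundary points of `K` that have a unique outer unit normal. -/
def regularBoundary {n : ℕ} (K : Set (EuclideanSpace ℝ (Fin n))) :
    Set (EuclideanSpace ℝ (Fin n)) :=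
  {x | x ∈ frontier K ∧ ∃! u : UnitSphere n, IsOuterNormal K x u}

/-- The Gauss map `ν_K : ∂'K → S^{n-1}`. -/
def gaussMap {n : ℕ} (K : Set (EuclideanSpace ℝ (Fin n))) (x : regularBoundary K) :
    UnitSphere n :=
  x.2.2.choose

/-- The `L_p` surface area measure `S_p(K, ·)`, a Borel measure on the unit sphere:
`S_p(K, ω) = ∫_{ν_K⁻¹(ω)} (x · ν_K(x))^{1-p} dℋ^{n-1}(x)`
(see `lpSurfaceAreaMeasure_apply`). Here `μHE[n - 1]` is the `(n-1)`-dimensional Hausdorff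
measure, normalized to agree with `(n-1)`-dimensional volume. -/
def lpSurfaceAreaMeasure {n : ℕ} (p : ℝ) (K : Set (EuclideanSpace ℝ (Fin n))) :
    Measure (UnitSphere n) :=
  Measure.map (gaussMap K)
    (((μHE[n - 1] : Measure (EuclideanSpace ℝ (Fin n))).comap
      (Subtype.val : regularBoundary K → EuclideanSpace ℝ (Fin n))).withDensity
      (fun x => ENNReal.ofReal
        ((inner ℝ (x : EuclideanSpace ℝ (Fin n))
          (gaussMap K x : EuclideanSpace ℝ (Fin n))) ^ (1 - p))))

/-- The closed hemisphere of `S^{n-1}` centred at `w`. -/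
def closedHemisphere {n : ℕ} (w : UnitSphere n) : Set (UnitSphere n) :=
  {v | 0 ≤ inner ℝ (v : EuclideanSpace ℝ (Fin n)) (w : EuclideanSpace ℝ (Fin n))}

theorem gaussMap_spec {n : ℕ} (K : Set (EuclideanSpace ℝ (Fin n))) (x : regularBoundary K) :
    IsOuterNormal K x (gaussMap K x) :=
  x.2.2.choose_spec.1

theorem isClosed_isOuterNormal {n : ℕ} (K : Set (EuclideanSpace ℝ (Fin n))) :
    IsClosed {q : EuclideanSpace ℝ (Fin n) × UnitSphere n | IsOuterNormal K q.1 q.2} := by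
  simp only [IsOuterNormal, Set.ofPred_forall]
  refine isClosed_iInter fun y => isClosed_iInter fun _ => ?_
  exact isClosed_le (by fun_prop) (by fun_prop)

theorem continuous_gaussMap {n : ℕ} (K : Set (EuclideanSpace ℝ (Fin n))) :
    Continuous (gaussMap K) := by
  refine continuous_iff_isClosed.2 fun C hC => ?_
  have h1 : IsClosed (Prod.fst '' ({q : EuclideanSpace ℝ (Fin n) × UnitSphere n |
      IsOuterNormal K q.1 q.2} ∩ Prod.snd ⁻¹' C)) :=
    isClosedMap_fst_of_compactSpace _
      ((isClosed_isOuterNormal K).inter (hC.preimage continuous_snd))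
  convert h1.preimage (continuous_subtype_val (p := fun x => x ∈ regularBoundary K)) using 1
  ext x
  constructor
  · intro hx
    exact ⟨(x, gaussMap K x), ⟨gaussMap_spec K x, hx⟩, rfl⟩
  · rintro ⟨⟨y, u⟩, ⟨h, hu⟩, hy⟩
    have hy' : y = x := hy
    subst hy'
    have : u = gaussMap K x := x.2.2.unique h (gaussMap_spec K x)
    simpa [← this] using hu

theorem measurableSet_regularBoundary {n : ℕ} (K : Set (EuclideanSpace ℝ (Fin n))) :
    MeasurableSet (regularBoundary K) := by
  have hA : IsClosed {x : EuclideanSpace ℝ (Fin n) | ∃ u : UnitSphere n, IsOuterNormal K x u} := by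
    convert isClosedMap_fst_of_compactSpace _ (isClosed_isOuterNormal K) using 1
    ext x
    simp
  have hB : ∀ m : ℕ, IsClosed {x : EuclideanSpace ℝ (Fin n) | ∃ q : UnitSphere n × UnitSphere n,
      IsOuterNormal K x q.1 ∧ IsOuterNormal K x q.2 ∧ 1 / ((m : ℝ) + 1) ≤ dist q.1 q.2} := by
    intro m
    have hc : IsClosed {r : EuclideanSpace ℝ (Fin n) × (UnitSphere n × UnitSphere n) |
        IsOuterNormal K r.1 r.2.1 ∧ IsOuterNormal K r.1 r.2.2 ∧
          1 / ((m : ℝ) + 1) ≤ dist r.2.1 r.2.2} := by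
      refine IsClosed.inter ?_ (IsClosed.inter ?_ ?_)
      · exact (isClosed_isOuterNormal K).preimage
          (f := fun r : EuclideanSpace ℝ (Fin n) × (UnitSphere n × UnitSphere n) => (r.1, r.2.1))
          (by fun_prop)
      · exact (isClosed_isOuterNormal K).preimage
          (f := fun r : EuclideanSpace ℝ (Fin n) × (UnitSphere n × UnitSphere n) => (r.1, r.2.2))
          (by fun_prop)
      · exact isClosed_le continuous_const
          ((continuous_fst.comp continuous_snd).dist (continuous_snd.comp continuous_snd))
    convert isClosedMap_fst_of_compactSpace _ hc using 1
    ext x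
    simp
  have key : regularBoundary K = (frontier K ∩ {x | ∃ u : UnitSphere n, IsOuterNormal K x u}) \
      ⋃ m : ℕ, {x | ∃ q : UnitSphere n × UnitSphere n,
        IsOuterNormal K x q.1 ∧ IsOuterNormal K x q.2 ∧ 1 / ((m : ℝ) + 1) ≤ dist q.1 q.2} := by
    ext x
    simp only [regularBoundary, Set.mem_ofPred_eq, Set.mem_sdiff, Set.mem_inter_iff, Set.mem_iUnion]
    constructor
    · rintro ⟨hx, u, hu, huniq⟩
      refine ⟨⟨hx, u, hu⟩, ?_⟩
      rintro ⟨m, ⟨v, w⟩, hv, hw, hd⟩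
      have hvw : v = w := (huniq v hv).trans (huniq w hw).symm
      have hpos : (0 : ℝ) < 1 / ((m : ℝ) + 1) := by positivity
      simp only [hvw, dist_self] at hd
      linarith
    · rintro ⟨⟨hx, u, hu⟩, hn⟩
      refine ⟨hx, u, hu, fun v hv => ?_⟩
      by_contra hne
      obtain ⟨m, hm⟩ := exists_nat_one_div_lt (dist_pos.2 hne)
      exact hn ⟨m, (v, u), hv, hu, hm.le⟩
  rw [key]
  exact (isClosed_frontier.measurableSet.inter hA.measurableSet).diff
    (MeasurableSet.iUnion fun m => (hB m).measurableSet)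

/-- The defining formula `S_p(K, ω) = ∫_{ν_K⁻¹(ω)} (x · ν_K(x))^{1-p} dℋ^{n-1}(x)`. -/
theorem lpSurfaceAreaMeasure_apply {n : ℕ} (p : ℝ) (K : Set (EuclideanSpace ℝ (Fin n)))
    {ω : Set (UnitSphere n)} (hω : MeasurableSet ω) :
    lpSurfaceAreaMeasure p K ω =
      ∫⁻ x in gaussMap K ⁻¹' ω, ENNReal.ofReal
        ((inner ℝ (x : EuclideanSpace ℝ (Fin n))
          (gaussMap K x : EuclideanSpace ℝ (Fin n))) ^ (1 - p))
        ∂((μHE[n - 1] : Measure (EuclideanSpace ℝ (Fin n))).comap Subtype.val) := by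
  have hν : Measurable (gaussMap K) := (continuous_gaussMap K).measurable
  rw [lpSurfaceAreaMeasure, Measure.map_apply hν hω, withDensity_apply _ (hν hω)]

/-- The measure on `∂'K` used above is the restriction of the Hausdorff measure of `ℝⁿ`. -/
theorem comap_hausdorff_apply {n : ℕ} (K : Set (EuclideanSpace ℝ (Fin n)))
    (A : Set (regularBoundary K)) :
    (μHE[n - 1] : Measure (EuclideanSpace ℝ (Fin n))).comap Subtype.val A =
      (μHE[n - 1] : Measure (EuclideanSpace ℝ (Fin n))) (Subtype.val '' A) :=
  (MeasurableEmbedding.subtype_coe (measurableSet_regularBoundary K)).comap_apply _ _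

end LpMinkowski

end

/-!
The polytope is sought in the form `polyhedron u h = {x | ⟪x, u k⟫ ≤ h k for all k}`, with the
given vectors as facet normals and unknown support numbers `h k > 0`. Its `L_p` surface area
measure is the sum of the point masses `h k ^ (1 - p) * facetArea u h k` at `u k`
(`lpSurfaceAreaMeasure_polyhedron`): the regular boundary points are exactly those of the open
facets, and the Gauss map is constant on each of them. The theorem therefore asks for a solution of
the finite system `h k ^ (1 - p) * facetArea u h k = α k`.

The system is the Euler–Lagrange equation of a finite-dimensional problem: maximize the volume of
`polyhedron u h` among all `h ≥ 0` with `∑ k, α k * h k ^ p = 1`. A maximizer exists, because the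
constraint set is compact and the volume is continuous in `h` (`exists_isVolumeMaximizer`). Fubini's
theorem, applied to the slices parallel to a facet, shows that the partial derivative of the volume
in `h k` is the area of the `k`-th facet (`hasDerivAt_measureReal_polyhedron_update`). Where
`h k > 0` it follows that the facet area is a fixed multiple of `α k * h k ^ (p - 1)`; as `p ≠ n`, a
dilation turns the factor into one.

It remains to see that `h k > 0` for all `k`, that is, that the origin is an interior point. For
`p = 1` and balanced weights, the problem is invariant under translations of the polytope, which
therefore may be moved. For `p > 1`, increasing a vanishing `h k` costs nothing to first order, so
that the facets through the origin have area zero (`IsVolumeMaximizer.facetArea_eq_zero`);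
inequalities with degenerate facets are redundant (`mem_polyhedron_of_facetArea_eq_zero`), and
dropping all those with `h k = 0` leaves a polytope that contains a neighbourhood of the origin.
-/

namespace LpMinkowski

open Filter Topology Module

open scoped Pointwise

/-! ### Polyhedra -/

/-- The polyhedron `{x | ⟪x, w i⟫ ≤ b i for all i}`. -/
def polyhedron {ι E : Type*} [NormedAddCommGroup E] [InnerProductSpace ℝ E] (w : ι → E)
    (b : ι → ℝ) : Set E :=
  {x | ∀ i, inner ℝ x (w i) ≤ b i}

section General

variable {ι E : Type*} [NormedAddCommGroup E] [InnerProductSpace ℝ E]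

theorem mem_polyhedron {w : ι → E} {b : ι → ℝ} {x : E} :
    x ∈ polyhedron w b ↔ ∀ i, inner ℝ x (w i) ≤ b i := Iff.rfl

theorem isClosed_polyhedron (w : ι → E) (b : ι → ℝ) : IsClosed (polyhedron w b) := by
  simp only [polyhedron, Set.ofPred_forall]
  exact isClosed_iInter fun i => isClosed_le (by fun_prop) continuous_const

theorem convex_polyhedron (w : ι → E) (b : ι → ℝ) : Convex ℝ (polyhedron w b) := by
  intro x hx y hy s t hs ht hst i
  rw [inner_add_left, real_inner_smul_left, real_inner_smul_left]
  calc _ ≤ s * b i + t * b i :=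
        add_le_add (mul_le_mul_of_nonneg_left (hx i) hs) (mul_le_mul_of_nonneg_left (hy i) ht)
    _ = b i := by rw [← add_mul, hst, one_mul]

theorem polyhedron_smul (w : ι → E) (b : ι → ℝ) {s : ℝ} (hs : 0 < s) :
    polyhedron w (s • b) = s • polyhedron w b := by
  ext x
  rw [Set.mem_smul_set_iff_inv_smul_mem₀ hs.ne']
  simp only [mem_polyhedron, real_inner_smul_left, Pi.smul_apply, smul_eq_mul]
  exact forall_congr' fun i => (inv_mul_le_iff₀ hs).symm

theorem isOpen_setOf_forall_inner_lt [Finite ι] (u : ι → E) (h : ι → ℝ) :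
    IsOpen {x | ∀ k, inner ℝ x (u k) < h k} := by
  simp only [Set.ofPred_forall]
  exact isOpen_iInter_of_finite fun k => isOpen_lt (by fun_prop) continuous_const

theorem mem_interior_polyhedron [Finite ι] {u : ι → E} {h : ι → ℝ} {x : E}
    (hx : ∀ k, inner ℝ x (u k) < h k) : x ∈ interior (polyhedron u h) :=
  mem_interior.2 ⟨{x | ∀ k, inner ℝ x (u k) < h k}, fun _ hy k => (hy k).le,
    isOpen_setOf_forall_inner_lt u h, hx⟩

theorem extremePoints_polyhedron_finite [Finite ι] (u : ι → E) (h : ι → ℝ) :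
    ((polyhedron u h).extremePoints ℝ).Finite := by
  -- An extreme point is determined by the set of inequalities that are tight at it.
  refine Set.Finite.of_finite_image (f := fun x => {k | inner ℝ x (u k) = h k})
    (Set.toFinite _) ?_
  intro x hx y hy hxy
  by_contra hne
  have hxP := hx.1
  have hyP := hy.1
  -- Extend the segment from `y` to `x` slightly beyond `x`.
  have hev : ∀ k, ∀ᶠ t : ℝ in 𝓝[>] 0, inner ℝ (x + t • (x - y)) (u k) ≤ h k := by
    intro k
    by_cases hk : inner ℝ x (u k) = h k
    · have hk' : inner ℝ y (u k) = h k := (Set.ext_iff.1 hxy k).1 hk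
      exact Eventually.of_forall fun t => by
        simp [inner_add_left, real_inner_smul_left, inner_sub_left, hk, hk']
    · have hlt : inner ℝ (x + (0 : ℝ) • (x - y)) (u k) < h k := by
        simpa using lt_of_le_of_ne (hxP k) hk
      have hc : Continuous fun t : ℝ => inner ℝ (x + t • (x - y)) (u k) := by fun_prop
      exact ((hc.tendsto 0).eventually (gt_mem_nhds hlt)).filter_mono nhdsWithin_le_nhds |>.mono
        fun t ht => ht.le
  obtain ⟨t, htP, ht⟩ := ((eventually_all.2 hev).and self_mem_nhdsWithin).exists
  have ht : 0 < t := ht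
  have hmem : x ∈ openSegment ℝ (x + t • (x - y)) y := by
    refine ⟨1 / (1 + t), t / (1 + t), by positivity, by positivity, by field_simp, ?_⟩
    have h1 : (1 + t) ≠ 0 := by positivity
    rw [← smul_right_injective E h1 |>.eq_iff]
    have h2 : (1 + t) * (1 / (1 + t)) = 1 := by field_simp
    have h3 : (1 + t) * (t / (1 + t)) = t := by field_simp
    rw [smul_add, smul_smul, smul_smul, h2, h3, one_smul, smul_sub, add_smul, one_smul]
    abel
  have h0 : t • (x - y) = 0 := by simpa using hx.2 htP hyP hmem
  exact hne (sub_eq_zero.1 ((smul_eq_zero.1 h0).resolve_left ht.ne'))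

variable [FiniteDimensional ℝ E]

/-- Finitely many vectors that meet every open half-space do so uniformly. -/
theorem exists_forall_mul_norm_le_inner [Finite ι] {u : ι → E}
    (hu : ∀ x : E, x ≠ 0 → ∃ k, 0 < inner ℝ x (u k)) :
    ∃ δ > 0, ∀ x : E, x ≠ 0 → ∃ k, δ * ‖x‖ ≤ inner ℝ x (u k) := by
  have := Fintype.ofFinite ι
  rcases subsingleton_or_nontrivial E with hE | hE
  · exact ⟨1, one_pos, fun x hx => (hx (Subsingleton.elim _ _)).elim⟩
  obtain ⟨x₀, hx₀⟩ := exists_ne (0 : E)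
  have hne : (Finset.univ : Finset ι).Nonempty := ⟨(hu x₀ hx₀).choose, Finset.mem_univ _⟩
  obtain ⟨z, hz, hmin⟩ := (isCompact_sphere (0 : E) 1).exists_isMinOn
    (NormedSpace.sphere_nonempty.2 zero_le_one)
    (f := fun x => Finset.univ.sup' hne fun k => inner ℝ x (u k))
    (Continuous.finset_sup'_apply hne fun k _ => by fun_prop).continuousOn
  have hz0 : z ≠ 0 := by
    rintro rfl
    simp at hz
  refine ⟨Finset.univ.sup' hne fun k => inner ℝ z (u k), ?_, fun x hx => ?_⟩
  · obtain ⟨k, hk⟩ := hu z hz0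
    exact hk.trans_le (Finset.le_sup' (fun k => inner ℝ z (u k)) (Finset.mem_univ k))
  · have hx' : 0 < ‖x‖ := norm_pos_iff.2 hx
    have hm := hmin (show (‖x‖⁻¹ • x) ∈ Metric.sphere (0 : E) 1 by
      simp [norm_smul, hx'.ne'])
    obtain ⟨k, -, hk⟩ := Finset.exists_mem_eq_sup' hne fun k => inner ℝ (‖x‖⁻¹ • x) (u k)
    refine ⟨k, ?_⟩
    rw [Set.mem_ofPred_eq] at hm
    simp only [hk] at hm
    rw [real_inner_smul_left] at hm
    rwa [mul_comm, ← le_inv_mul_iff₀ hx']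

theorem exists_polyhedron_subset_closedBall [Finite ι] {u : ι → E}
    (hu : ∀ x : E, x ≠ 0 → ∃ k, 0 < inner ℝ x (u k)) (M : ℝ) :
    ∃ R, ∀ h : ι → ℝ, (∀ k, h k ≤ M) → polyhedron u h ⊆ Metric.closedBall 0 R := by
  obtain ⟨δ, hδ, H⟩ := exists_forall_mul_norm_le_inner hu
  refine ⟨max (M / δ) 0, fun h hM x hx => ?_⟩
  rw [mem_closedBall_zero_iff]
  rcases eq_or_ne x 0 with rfl | hx0
  · simp
  obtain ⟨k, hk⟩ := H x hx0
  refine le_max_of_le_left ?_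
  rw [le_div_iff₀ hδ, mul_comm]
  exact hk.trans ((hx k).trans (hM k))

theorem isCompact_polyhedron [Finite ι] {u : ι → E}
    (hu : ∀ x : E, x ≠ 0 → ∃ k, 0 < inner ℝ x (u k)) (h : ι → ℝ) :
    IsCompact (polyhedron u h) := by
  obtain ⟨M, hM⟩ := (Set.finite_range h).bddAbove
  obtain ⟨R, hR⟩ := exists_polyhedron_subset_closedBall hu M
  exact (isCompact_closedBall (0 : E) R).of_isClosed_subset (isClosed_polyhedron u h)
    (hR h fun k => hM ⟨k, rfl⟩)

/-- On a neighbourhood of `h₀` all polyhedra lie in a common ball. -/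
theorem eventually_polyhedron_subset_closedBall [Finite ι] {u : ι → E}
    (hu : ∀ x : E, x ≠ 0 → ∃ k, 0 < inner ℝ x (u k)) (h₀ : ι → ℝ) :
    ∃ R, ∀ᶠ h in 𝓝 h₀, polyhedron u h ⊆ Metric.closedBall 0 R := by
  obtain ⟨M, hM⟩ := (Set.finite_range h₀).bddAbove
  obtain ⟨R, hR⟩ := exists_polyhedron_subset_closedBall hu (M + 1)
  refine ⟨R, ?_⟩
  have : ∀ k, ∀ᶠ h : ι → ℝ in 𝓝 h₀, h k < M + 1 := fun k =>
    ((continuous_apply k).tendsto h₀).eventually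
      (gt_mem_nhds ((hM ⟨k, rfl⟩ : h₀ k ≤ M).trans_lt (lt_add_one M)))
  filter_upwards [eventually_all.2 this] with h hh using hR h fun k => (hh k).le

/-- A bounded polyhedron is the convex hull of a finite set: by the Krein–Milman theorem it is
spanned by its extreme points, of which there are finitely many. -/
theorem exists_finset_polyhedron_eq_convexHull [Finite ι] {u : ι → E}
    (hu : ∀ x : E, x ≠ 0 → ∃ k, 0 < inner ℝ x (u k)) (h : ι → ℝ) :
    ∃ s : Finset E, polyhedron u h = convexHull ℝ (s : Set E) := by
  have hfin := extremePoints_polyhedron_finite u h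
  refine ⟨hfin.toFinset, ?_⟩
  rw [Set.Finite.coe_toFinset, ← hfin.isClosed_convexHull (𝕜 := ℝ) |>.closure_eq,
    closure_convexHull_extremePoints (isCompact_polyhedron hu h) (convex_polyhedron u h)]

/-! ### Measure of polyhedra -/

variable [MeasurableSpace E] [BorelSpace E]

theorem addHaar_hyperplane (μ : Measure E) [μ.IsAddHaarMeasure] {w : E} (hw : w ≠ 0) (b : ℝ) :
    μ {x | inner ℝ x w = b} = 0 := by
  rcases Set.eq_empty_or_nonempty {x : E | inner ℝ x w = b} with h | ⟨x₀, hx₀⟩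
  · simp [h]
  have h : {x : E | inner ℝ x w = b} = (AffineSubspace.mk' x₀ (ℝ ∙ w)ᗮ : Set E) := by
    ext x
    have hx₀' : inner ℝ x₀ w = b := hx₀
    simp [AffineSubspace.mem_mk', Submodule.mem_orthogonal_singleton_iff_inner_left,
      inner_sub_left, hx₀', sub_eq_zero]
  rw [h]
  refine Measure.addHaar_affineSubspace μ _ fun htop => hw ?_
  have h2 := congrArg AffineSubspace.direction htop
  rw [AffineSubspace.direction_mk', AffineSubspace.direction_top,
    Submodule.orthogonal_eq_top_iff] at h2
  exact Submodule.span_singleton_eq_bot.1 h2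

/-- The measure of a polyhedron depends continuously on the right-hand sides of its inequalities,
as long as it stays in a fixed bounded set and no inequality degenerates to `0 ≤ 0`. -/
theorem tendsto_measure_polyhedron [Finite ι] (μ : Measure E) [μ.IsAddHaarMeasure] {w : ι → E}
    {b₀ : ι → ℝ} (hw : ∀ i, w i = 0 → b₀ i ≠ 0) {R : ℝ}
    (hR : ∀ᶠ b in 𝓝 b₀, polyhedron w b ⊆ Metric.closedBall 0 R) :
    Tendsto (fun b => μ (polyhedron w b)) (𝓝 b₀) (𝓝 (μ (polyhedron w b₀))) := by
  refine tendsto_measure_of_ae_tendsto_indicator (𝓝 b₀) (isClosed_polyhedron w b₀).measurableSet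
    (fun b => (isClosed_polyhedron w b).measurableSet)
    (Metric.isClosed_closedBall (x := (0 : E)) (ε := R)).measurableSet
    measure_closedBall_lt_top.ne hR ?_
  have hae : ∀ᵐ x ∂μ, ∀ i, inner ℝ x (w i) ≠ b₀ i := by
    rw [ae_all_iff]
    intro i
    by_cases hi : w i = 0
    · exact Eventually.of_forall fun x => by simpa [hi] using (hw i hi).symm
    · exact measure_eq_zero_iff_ae_notMem.1 (addHaar_hyperplane μ hi (b₀ i))
  filter_upwards [hae] with x hx
  have hi : ∀ i, ∀ᶠ b : ι → ℝ in 𝓝 b₀, (inner ℝ x (w i) ≤ b i ↔ inner ℝ x (w i) ≤ b₀ i) := by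
    intro i
    have hc : Tendsto (fun b : ι → ℝ => b i) (𝓝 b₀) (𝓝 (b₀ i)) := (continuous_apply i).tendsto b₀
    rcases lt_or_gt_of_ne (hx i) with h | h
    · filter_upwards [hc.eventually (lt_mem_nhds h)] with b hb using iff_of_true hb.le h.le
    · filter_upwards [hc.eventually (gt_mem_nhds h)] with b hb using
        iff_of_false hb.not_ge h.not_ge
  filter_upwards [eventually_all.2 hi] with b hb using forall_congr' hb

theorem continuous_measureReal_polyhedron [Finite ι] (μ : Measure E) [μ.IsAddHaarMeasure]
    {u : ι → E} (hu : ∀ x : E, x ≠ 0 → ∃ k, 0 < inner ℝ x (u k)) (hu0 : ∀ k, u k ≠ 0) :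
    Continuous fun h => μ.real (polyhedron u h) := by
  refine continuous_iff_continuousAt.2 fun h₀ => ?_
  obtain ⟨R, hR⟩ := eventually_polyhedron_subset_closedBall hu h₀
  exact (ENNReal.tendsto_toReal (isCompact_polyhedron hu h₀).measure_lt_top.ne).comp
    (tendsto_measure_polyhedron μ (fun i hi => (hu0 i hi).elim) hR)

/-- A polyhedron of positive measure has a point at which every inequality is strict. -/
theorem exists_forall_inner_lt [Finite ι] (μ : Measure E) [μ.IsAddHaarMeasure] {u : ι → E}
    (hu0 : ∀ k, u k ≠ 0) {h : ι → ℝ} (hV : μ (polyhedron u h) ≠ 0) :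
    ∃ c, ∀ k, inner ℝ c (u k) < h k := by
  have hnull : μ (⋃ k, {x | inner ℝ x (u k) = h k}) = 0 :=
    measure_iUnion_null fun k => addHaar_hyperplane μ (hu0 k) (h k)
  have hne : (polyhedron u h \ ⋃ k, {x | inner ℝ x (u k) = h k}).Nonempty := by
    by_contra hemp
    rw [Set.not_nonempty_iff_eq_empty, Set.sdiff_eq_empty] at hemp
    exact hV (measure_mono_null hemp hnull)
  obtain ⟨c, hc, hc'⟩ := hne
  simp only [Set.mem_iUnion, not_exists] at hc'
  exact ⟨c, fun k => lt_of_le_of_ne (hc k) (hc' k)⟩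

end General

/-! ### Slices by parallel hyperplanes and the first variation of volume -/

section Slices

variable {n : ℕ} {v : EuclideanSpace ℝ (Fin n)}

theorem finrank_orthogonal_span_singleton_eq_sub (hv : v ≠ 0) : finrank ℝ (ℝ ∙ v)ᗮ = n - 1 := by
  have h := (ℝ ∙ v).finrank_add_finrank_orthogonal
  rw [finrank_span_singleton hv, finrank_euclideanSpace_fin] at h
  omega

theorem inner_smul_add_coe_orthogonal (hv : ‖v‖ = 1) (s : ℝ) (y : (ℝ ∙ v)ᗮ) :
    inner ℝ (s • v + (y : EuclideanSpace ℝ (Fin n))) v = s := by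
  rw [inner_add_left, real_inner_smul_left, real_inner_self_eq_norm_sq, hv,
    Submodule.mem_orthogonal_singleton_iff_inner_left.1 y.2]
  ring

theorem range_smul_add_coe_orthogonal (hv : ‖v‖ = 1) (s : ℝ) :
    Set.range (fun y : (ℝ ∙ v)ᗮ => s • v + (y : EuclideanSpace ℝ (Fin n))) =
      {x | inner ℝ x v = s} := by
  ext x
  constructor
  · rintro ⟨y, rfl⟩
    exact inner_smul_add_coe_orthogonal hv s y
  · intro hx
    have hx : inner ℝ x v = s := hx
    refine ⟨⟨x - s • v, ?_⟩, by simp⟩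
    rw [Submodule.mem_orthogonal_singleton_iff_inner_left, inner_sub_left, real_inner_smul_left,
      real_inner_self_eq_norm_sq, hv, hx]
    ring

/-- The Hausdorff measure of a hyperplane section, as Lebesgue measure on the orthogonal
complement of the normal. -/
theorem euclideanHausdorffMeasure_inter_hyperplane (hv : ‖v‖ = 1) (s : ℝ)
    (B : Set (EuclideanSpace ℝ (Fin n))) :
    (μHE[n - 1] : Measure (EuclideanSpace ℝ (Fin n))) (B ∩ {x | inner ℝ x v = s}) =
      volume {y : (ℝ ∙ v)ᗮ | s • v + (y : EuclideanSpace ℝ (Fin n)) ∈ B} := by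
  have hiso : Isometry (fun y : (ℝ ∙ v)ᗮ => s • v + (y : EuclideanSpace ℝ (Fin n))) :=
    (isometry_add_left (s • v)).comp isometry_subtype_coe
  have hv0 : v ≠ 0 := norm_ne_zero_iff.1 (by rw [hv]; exact one_ne_zero)
  rw [← range_smul_add_coe_orthogonal hv s, ← hiso.euclideanHausdorffMeasure_preimage,
    ← InnerProductSpace.euclideanHausdorffMeasure_eq_volume,
    finrank_orthogonal_span_singleton_eq_sub hv0]
  rfl

theorem volume_eq_lintegral_slice (hv : ‖v‖ = 1) {B : Set (EuclideanSpace ℝ (Fin n))}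
    (hB : MeasurableSet B) :
    volume B = ∫⁻ s : ℝ, volume {y : (ℝ ∙ v)ᗮ | s • v + (y : EuclideanSpace ℝ (Fin n)) ∈ B} := by
  have hv0 : v ≠ 0 := norm_ne_zero_iff.1 (by rw [hv]; exact one_ne_zero)
  have h := EuclideanGeometry.euclideanHausdorffMeasure_eq_lintegral
    (0 : EuclideanSpace ℝ (Fin n)) hv0 hB
  rw [finrank_euclideanSpace_fin, EuclideanSpace.euclideanHausdorffMeasure_eq_volume] at h
  have h1 : ‖v‖ₑ = 1 := by rw [← ofReal_norm, hv, ENNReal.ofReal_one]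
  rw [h, h1, one_mul]
  refine lintegral_congr fun s => ?_
  rw [← euclideanHausdorffMeasure_inter_hyperplane hv]
  congr 2
  ext x
  simp [AffineSubspace.mem_mk', Submodule.mem_orthogonal_singleton_iff_inner_left,
      inner_sub_left, sub_eq_zero, real_inner_smul_left, hv]

end Slices

section FacetArea

variable {ι : Type*} {n : ℕ}

/-- The area of the facet of the polyhedron `{x | ⟪x, u i⟫ ≤ h i}` with outer normal `u k`. -/
noncomputable def facetArea (u : ι → EuclideanSpace ℝ (Fin n)) (h : ι → ℝ) (k : ι) : ℝ :=
  (μHE[n - 1] : Measure (EuclideanSpace ℝ (Fin n))).real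
    (polyhedron u h ∩ {x | inner ℝ x (u k) = h k})

/-- The projections of the normals `u j` to the hyperplane orthogonal to `u k`. They are the
normals of the slices of a polyhedron by the hyperplanes parallel to its `k`-th facet. -/
noncomputable def sliceNormal (u : ι → EuclideanSpace ℝ (Fin n)) (k j : ι) : (ℝ ∙ u k)ᗮ :=
  (ℝ ∙ u k)ᗮ.orthogonalProjectionOnto (u j)

open Classical in
/-- The right-hand sides of the inequalities cutting out the slice at height `s` in direction
`u k`. The `k`-th inequality, which does not constrain a slice, is replaced by `0 ≤ 1`. -/
noncomputable def sliceBound (u : ι → EuclideanSpace ℝ (Fin n)) (h : ι → ℝ) (k : ι) (s : ℝ)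
    (j : ι) : ℝ :=
  if j = k then 1 else h j - s * inner ℝ (u k) (u j)

variable {u : ι → EuclideanSpace ℝ (Fin n)} {h : ι → ℝ} {k : ι}

theorem inner_sliceNormal (j : ι) (y : (ℝ ∙ u k)ᗮ) :
    inner ℝ y (sliceNormal u k j) = inner ℝ (y : EuclideanSpace ℝ (Fin n)) (u j) := by
  rw [sliceNormal, Submodule.inner_orthogonalProjectionOnto_eq_of_mem_left]

theorem sliceNormal_self : sliceNormal u k k = 0 := by
  rw [sliceNormal, Submodule.orthogonalProjectionOnto_eq_zero_iff]
  exact Submodule.le_orthogonal_orthogonal _ (Submodule.mem_span_singleton_self _)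

theorem continuous_sliceBound : Continuous fun s => sliceBound u h k s := by
  refine continuous_pi fun j => ?_
  unfold sliceBound
  split_ifs <;> fun_prop

open Classical in
theorem setOf_mem_polyhedron_update (hk : ‖u k‖ = 1) (s τ : ℝ) :
    {y : (ℝ ∙ u k)ᗮ | s • u k + (y : EuclideanSpace ℝ (Fin n)) ∈
        polyhedron u (Function.update h k τ)} =
      if s ≤ τ then polyhedron (sliceNormal u k) (sliceBound u h k s) else ∅ := by
  ext y
  have hyk := inner_smul_add_coe_orthogonal hk s y
  split_ifs with hs
  · simp only [Set.mem_ofPred_eq, mem_polyhedron]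
    refine forall_congr' fun j => ?_
    rcases eq_or_ne j k with rfl | hj
    · rw [hyk, Function.update_self, sliceNormal_self, inner_zero_right, sliceBound, if_pos rfl]
      exact iff_of_true hs zero_le_one
    · rw [Function.update_of_ne hj, inner_sliceNormal, sliceBound, if_neg hj, inner_add_left,
        real_inner_smul_left, le_sub_iff_add_le']
  · simp only [Set.mem_ofPred_eq, Set.mem_empty_iff_false, iff_false]
    intro hy
    have := hy k
    rw [hyk, Function.update_self] at this
    exact hs this

theorem facetArea_eq_measureReal_slice (hk : ‖u k‖ = 1) :
    facetArea u h k =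
      volume.real (polyhedron (sliceNormal u k) (sliceBound u h k (h k))) := by
  classical
  have := setOf_mem_polyhedron_update (u := u) (h := h) hk (h k) (h k)
  rw [Function.update_eq_self, if_pos le_rfl] at this
  rw [facetArea, Measure.real, euclideanHausdorffMeasure_inter_hyperplane hk, this, Measure.real]

theorem measurable_measure_slice [Finite ι] :
    Measurable fun s => volume (polyhedron (sliceNormal u k) (sliceBound u h k s)) := by
  have hS : MeasurableSet {q : ℝ × (ℝ ∙ u k)ᗮ |
      q.2 ∈ polyhedron (sliceNormal u k) (sliceBound u h k q.1)} := by
    simp only [mem_polyhedron, Set.ofPred_forall]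
    refine MeasurableSet.iInter fun j => (isClosed_le (by fun_prop) ?_).measurableSet
    exact (continuous_apply j).comp (continuous_sliceBound.comp continuous_fst)
  exact measurable_measure_prodMk_left hS

open Classical in
theorem volume_polyhedron_update [Finite ι] (hk : ‖u k‖ = 1) (τ : ℝ) :
    volume (polyhedron u (Function.update h k τ)) =
      ∫⁻ s in Set.Iic τ, volume (polyhedron (sliceNormal u k) (sliceBound u h k s)) := by
  rw [volume_eq_lintegral_slice hk (isClosed_polyhedron u _).measurableSet,
    ← lintegral_indicator measurableSet_Iic]
  refine lintegral_congr fun s => ?_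
  rw [setOf_mem_polyhedron_update hk]
  by_cases hs : s ≤ τ <;> simp [hs, Set.indicator]

/-- No inequality of the slice through the `k`-th facet degenerates to `0 ≤ 0`: the projection of
`u j` vanishes only if `u j = -u k`, and then a point with strict inequalities forces
`0 < h j + h k`. -/
theorem sliceBound_ne_zero (hunit : ∀ j, ‖u j‖ = 1) (hinj : Function.Injective u)
    {c : EuclideanSpace ℝ (Fin n)} (hc : ∀ j, inner ℝ c (u j) < h j) (j : ι)
    (hj : sliceNormal u k j = 0) : sliceBound u h k (h k) j ≠ 0 := by
  unfold sliceBound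
  split_ifs with hjk
  · exact one_ne_zero
  rw [sliceNormal, Submodule.orthogonalProjectionOnto_eq_zero_iff,
    Submodule.orthogonal_orthogonal, Submodule.mem_span_singleton] at hj
  obtain ⟨a, ha⟩ := hj
  have ha1 : |a| = 1 := by
    have := hunit j
    rwa [← ha, norm_smul, hunit k, mul_one, Real.norm_eq_abs] at this
  rcases eq_or_eq_neg_of_abs_eq ha1 with rfl | rfl
  · exact (hjk (hinj (by rw [← ha, one_smul]))).elim
  have h1 := hc k
  have h2 := hc j
  rw [← ha, real_inner_smul_right] at h2
  rw [← ha, real_inner_smul_right, real_inner_self_eq_norm_sq, hunit k]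
  intro h0
  linarith

open Classical in
/-- First variation of volume: moving one facet hyperplane outwards changes the volume at the rate
given by the area of that facet. -/
theorem hasDerivAt_measureReal_polyhedron_update [Finite ι] (hunit : ∀ j, ‖u j‖ = 1)
    (hinj : Function.Injective u) (hu : ∀ x, x ≠ 0 → ∃ k, 0 < inner ℝ x (u k))
    {c : EuclideanSpace ℝ (Fin n)} (hc : ∀ j, inner ℝ c (u j) < h j) (k : ι) :
    HasDerivAt (fun τ => volume.real (polyhedron u (Function.update h k τ)))
      (facetArea u h k) (h k) := by
  set A : ℝ → ℝ≥0∞ := fun s => volume (polyhedron (sliceNormal u k) (sliceBound u h k s)) with hA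
  have hAm : Measurable A := measurable_measure_slice
  have hfin : ∀ τ, ∫⁻ s in Set.Iic τ, A s ≠ ∞ := fun τ => by
    rw [← volume_polyhedron_update (hunit k)]
    exact (isCompact_polyhedron hu _).measure_lt_top.ne
  have hint : ∀ τ, IntegrableOn (fun s => (A s).toReal) (Set.Iic τ) := fun τ =>
    integrable_toReal_of_lintegral_ne_top hAm.aemeasurable (hfin τ)
  have hV : ∀ τ, volume.real (polyhedron u (Function.update h k τ)) =
      ∫ s in Set.Iic τ, (A s).toReal := fun τ => by
    rw [Measure.real, volume_polyhedron_update (hunit k), integral_toReal hAm.aemeasurable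
      (ae_lt_top hAm (hfin τ))]
  -- The slices near the facet lie in a common ball.
  obtain ⟨R, hR⟩ := eventually_polyhedron_subset_closedBall
    (u := sliceNormal u k) (fun y hy => by
      obtain ⟨j, hj⟩ := hu y (by simpa using hy)
      exact ⟨j, by rwa [inner_sliceNormal]⟩) (sliceBound u h k (h k))
  have hcont : ContinuousAt (fun s => (A s).toReal) (h k) := by
    have h1 := tendsto_measure_polyhedron volume
      (sliceBound_ne_zero hunit hinj hc) hR
    have h2 : Tendsto A (𝓝 (h k)) (𝓝 (A (h k))) :=
      h1.comp (continuous_sliceBound.tendsto (h k))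
    refine (ENNReal.tendsto_toReal ?_).comp h2
    exact ((measure_mono hR.self_of_nhds).trans_lt measure_closedBall_lt_top).ne
  have hd : HasDerivAt (fun τ => (∫ s in Set.Iic (h k), (A s).toReal) +
      ∫ s in (h k)..τ, (A s).toReal) ((A (h k)).toReal) (h k) :=
    (intervalIntegral.integral_hasDerivAt_right (by simp)
      (hAm.ennreal_toReal.stronglyMeasurable.stronglyMeasurableAtFilter) hcont).const_add _
  have hfun : (fun τ => volume.real (polyhedron u (Function.update h k τ))) =
      fun τ => (∫ s in Set.Iic (h k), (A s).toReal) + ∫ s in (h k)..τ, (A s).toReal := by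
    funext τ
    rw [hV, ← intervalIntegral.integral_Iic_sub_Iic (hint _) (hint _)]
    ring
  rw [hfun, facetArea_eq_measureReal_slice (hunit k)]
  exact hd

theorem facetArea_smul {s : ℝ} (hs : 0 < s) :
    facetArea u (s • h) k = s ^ (n - 1) * facetArea u h k := by
  have hset : polyhedron u (s • h) ∩ {x | inner ℝ x (u k) = (s • h) k} =
      s • (polyhedron u h ∩ {x | inner ℝ x (u k) = h k}) := by
    rw [Set.smul_set_inter₀ hs.ne', polyhedron_smul u h hs]
    congr 1
    ext x
    rw [Set.mem_smul_set_iff_inv_smul_mem₀ hs.ne']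
    simp only [Set.mem_ofPred_eq, real_inner_smul_left, Pi.smul_apply, smul_eq_mul]
    exact (inv_mul_eq_iff_eq_mul₀ hs.ne').symm
  rw [facetArea, hset, Measure.real, Measure.euclideanHausdorffMeasure_smul₀ _ hs.ne', facetArea,
    Measure.real]
  simp [ENNReal.smul_def, abs_of_pos hs]

/-- A facet hyperplane meeting the polyhedron in a set with nonempty relative interior cuts out a
facet of positive area. -/
theorem facetArea_pos [Finite ι] (hk : ‖u k‖ = 1) (hu : ∀ x, x ≠ 0 → ∃ k, 0 < inner ℝ x (u k))
    {U : Set (EuclideanSpace ℝ (Fin n))} (hU : IsOpen U)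
    (hUne : (U ∩ {x | inner ℝ x (u k) = h k}).Nonempty)
    (hsub : U ∩ {x | inner ℝ x (u k) = h k} ⊆ polyhedron u h) : 0 < facetArea u h k := by
  rw [facetArea_eq_measureReal_slice hk, Measure.real]
  refine ENNReal.toReal_pos (LT.lt.ne' ?_) (isCompact_polyhedron (fun y hy => by
      obtain ⟨j, hj⟩ := hu y (by simpa using hy)
      exact ⟨j, by rwa [inner_sliceNormal]⟩) _).measure_lt_top.ne
  have hpre : IsOpen {y : (ℝ ∙ u k)ᗮ | h k • u k + (y : EuclideanSpace ℝ (Fin n)) ∈ U} :=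
    hU.preimage (f := fun y : (ℝ ∙ u k)ᗮ => h k • u k + (y : EuclideanSpace ℝ (Fin n)))
      (by fun_prop)
  obtain ⟨z, hzU, hz⟩ := hUne
  rw [← range_smul_add_coe_orthogonal hk] at hz
  obtain ⟨y, rfl⟩ := hz
  refine (hpre.measure_pos volume ⟨y, hzU⟩).trans_le (measure_mono fun y' hy' => ?_)
  classical
  have h1 := setOf_mem_polyhedron_update (u := u) (h := h) hk (h k) (h k)
  rw [Function.update_eq_self, if_pos le_rfl] at h1
  rw [← h1]
  exact hsub ⟨hy', inner_smul_add_coe_orthogonal hk _ _⟩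

end FacetArea

/-! ### The variational problem -/

section Variational

theorem measureReal_polyhedron_smul {ι : Type*} {n : ℕ}
    {u : ι → EuclideanSpace ℝ (Fin n)} {h : ι → ℝ} {s : ℝ} (hs : 0 < s) :
    volume.real (polyhedron u (s • h)) = s ^ n * volume.real (polyhedron u h) := by
  rw [polyhedron_smul u h hs, Measure.real, Measure.addHaar_smul, finrank_euclideanSpace_fin,
    ENNReal.toReal_mul, Measure.real, ENNReal.toReal_ofReal (abs_nonneg _),
    abs_of_pos (pow_pos hs n)]

variable {ι : Type*} [Fintype ι] {n : ℕ}

/-- The `p`-th power sum `∑ k, α k * h k ^ p` that is held fixed when the volume is maximized. -/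
noncomputable def weightedPowerSum (α : ι → ℝ) (p : ℝ) (h : ι → ℝ) : ℝ :=
  ∑ k, α k * h k ^ p

/-- `h` maximizes the volume of `polyhedron u h` among the nonnegative vectors of weighted power
sum one. Since the volume is homogeneous of degree `n` and the power sum of degree `p`, this is
expressed by an inequality valid for nonnegative vectors without normalization. -/
structure IsVolumeMaximizer (u : ι → EuclideanSpace ℝ (Fin n)) (α : ι → ℝ) (p : ℝ)
    (h : ι → ℝ) : Prop where
  nonneg : ∀ k, 0 ≤ h k
  weightedPowerSum_eq_one : weightedPowerSum α p h = 1
  volume_pos : 0 < volume.real (polyhedron u h)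
  le_of_nonneg : ∀ h' : ι → ℝ, (∀ k, 0 ≤ h' k) → 0 < weightedPowerSum α p h' →
    volume.real (polyhedron u h') ≤
      volume.real (polyhedron u h) * weightedPowerSum α p h' ^ ((n : ℝ) / p)

variable {u : ι → EuclideanSpace ℝ (Fin n)} {α : ι → ℝ} {p : ℝ} {h : ι → ℝ}

theorem continuous_weightedPowerSum (hp : 0 ≤ p) : Continuous (weightedPowerSum α p) :=
  continuous_finsetSum _ fun k _ =>
    continuous_const.mul ((Real.continuous_rpow_const hp).comp (continuous_apply k))

theorem weightedPowerSum_smul {s : ℝ} (hs : 0 ≤ s) (hh : ∀ k, 0 ≤ h k) :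
    weightedPowerSum α p (s • h) = s ^ p * weightedPowerSum α p h := by
  simp only [weightedPowerSum, Finset.mul_sum, Pi.smul_apply, smul_eq_mul]
  refine Finset.sum_congr rfl fun k _ => ?_
  rw [Real.mul_rpow hs (hh k)]
  ring

theorem measureReal_polyhedron_pos (hu : ∀ x, x ≠ 0 → ∃ k, 0 < inner ℝ x (u k))
    {c : EuclideanSpace ℝ (Fin n)} (hc : ∀ j, inner ℝ c (u j) < h j) :
    0 < volume.real (polyhedron u h) :=
  ENNReal.toReal_pos
    (Measure.measure_pos_of_nonempty_interior volume ⟨c, mem_interior_polyhedron hc⟩).ne'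
    (isCompact_polyhedron hu h).measure_lt_top.ne

theorem IsVolumeMaximizer.exists_forall_inner_lt (H : IsVolumeMaximizer u α p h)
    (hunit : ∀ k, ‖u k‖ = 1) : ∃ c, ∀ k, inner ℝ c (u k) < h k := by
  refine LpMinkowski.exists_forall_inner_lt volume
    (fun k => norm_ne_zero_iff.1 (by rw [hunit k]; exact one_ne_zero)) fun h0 => ?_
  have := H.volume_pos
  simp [Measure.real, h0] at this

theorem exists_isVolumeMaximizer [Nonempty ι] (hp : 1 ≤ p) (hα : ∀ k, 0 < α k)
    (hunit : ∀ k, ‖u k‖ = 1) (hu : ∀ x, x ≠ 0 → ∃ k, 0 < inner ℝ x (u k)) :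
    ∃ h, IsVolumeMaximizer u α p h := by
  have hp0 : 0 < p := one_pos.trans_le hp
  have hα1 : 0 < weightedPowerSum α p 1 := by
    simp only [weightedPowerSum, Pi.one_apply, Real.one_rpow, mul_one]
    exact Finset.sum_pos (fun k _ => hα k) Finset.univ_nonempty
  -- Every nonnegative vector of positive power sum can be normalized.
  have hnorm : ∀ h : ι → ℝ, (∀ k, 0 ≤ h k) → 0 < weightedPowerSum α p h →
      ∃ t > 0, t ^ n = weightedPowerSum α p h ^ ((n : ℝ) / p) ∧
        weightedPowerSum α p (t⁻¹ • h) = 1 := by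
    intro h hh hS
    refine ⟨weightedPowerSum α p h ^ p⁻¹, Real.rpow_pos_of_pos hS _, ?_, ?_⟩
    · rw [← Real.rpow_natCast, ← Real.rpow_mul hS.le, inv_mul_eq_div]
    · rw [weightedPowerSum_smul (by positivity) hh, Real.inv_rpow (by positivity),
        Real.rpow_inv_rpow hS.le hp0.ne', inv_mul_cancel₀ hS.ne']
  set K : Set (ι → ℝ) := {h | (∀ k, 0 ≤ h k) ∧ weightedPowerSum α p h = 1} with hK
  have hKc : IsCompact K := by
    refine (isCompact_univ_pi (s := fun k => Set.Icc 0 ((α k)⁻¹ ^ p⁻¹))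
      fun k => isCompact_Icc).of_isClosed_subset ?_ ?_
    · exact (isClosed_Ici (a := (0 : ι → ℝ))).inter
        (isClosed_eq (continuous_weightedPowerSum hp0.le) continuous_const)
    · rintro h ⟨hh, hS⟩ k -
      refine ⟨hh k, ?_⟩
      have h1 : α k * h k ^ p ≤ 1 := by
        rw [← hS]
        exact Finset.single_le_sum (f := fun k => α k * h k ^ p)
          (fun j _ => mul_nonneg (hα j).le (Real.rpow_nonneg (hh j) p)) (Finset.mem_univ k)
      rw [Real.le_rpow_inv_iff_of_pos (hh k) (inv_pos.2 (hα k)).le hp0, ← one_div,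
        le_div_iff₀ (hα k), mul_comm]
      exact h1
  obtain ⟨t, ht, -, ht1⟩ := hnorm 1 (fun _ => zero_le_one) hα1
  have htK : t⁻¹ • (1 : ι → ℝ) ∈ K := ⟨fun k => by simpa using ht.le, ht1⟩
  obtain ⟨h₀, h₀K, hmax⟩ := hKc.exists_isMaxOn ⟨_, htK⟩
    (continuous_measureReal_polyhedron (volume : Measure (EuclideanSpace ℝ (Fin n))) hu
      fun k => norm_ne_zero_iff.1 (by rw [hunit k]; exact one_ne_zero)).continuousOn
  refine ⟨h₀, h₀K.1, h₀K.2, ?_, fun h hh hS => ?_⟩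
  · refine lt_of_lt_of_le ?_ (hmax htK)
    exact measureReal_polyhedron_pos (c := 0) hu fun k => by simpa using ht
  · obtain ⟨s, hs, hsn, hs1⟩ := hnorm h hh hS
    have h1 : volume.real (polyhedron u (s⁻¹ • h)) ≤ volume.real (polyhedron u h₀) :=
      hmax (show s⁻¹ • h ∈ K from ⟨fun k => mul_nonneg (inv_pos.2 hs).le (hh k), hs1⟩)
    rw [measureReal_polyhedron_smul (inv_pos.2 hs), inv_pow, inv_mul_le_iff₀ (pow_pos hs n),
      hsn, mul_comm] at h1
    exact h1

open Classical in
theorem hasDerivAt_weightedPowerSum_update (hp : 1 ≤ p) (k : ι) :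
    HasDerivAt (fun τ => weightedPowerSum α p (Function.update h k τ))
      (α k * (p * h k ^ (p - 1))) (h k) := by
  have hfun : (fun τ => weightedPowerSum α p (Function.update h k τ)) =
      fun τ => α k * τ ^ p + ∑ j ∈ Finset.univ.erase k, α j * h j ^ p := by
    funext τ
    rw [weightedPowerSum, ← Finset.add_sum_erase _ _ (Finset.mem_univ k), Function.update_self]
    congr 1
    refine Finset.sum_congr rfl fun j hj => ?_
    rw [Function.update_of_ne (Finset.ne_of_mem_erase hj)]
  rw [hfun]
  exact ((Real.hasDerivAt_rpow_const (Or.inr hp)).const_mul _).add_const _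

open Classical in
/-- The defect in the inequality that characterizes a maximizer `h`, as a function of the `k`-th
coordinate: its derivative at `h k`, and its nonnegativity near `h k`. -/
theorem IsVolumeMaximizer.hasDerivAt_defect (H : IsVolumeMaximizer u α p h) (hp : 1 ≤ p)
    (hunit : ∀ k, ‖u k‖ = 1) (hinj : Function.Injective u)
    (hu : ∀ x, x ≠ 0 → ∃ k, 0 < inner ℝ x (u k)) (k : ι) :
    ∃ g : ℝ → ℝ, g (h k) = 0 ∧ (∀ᶠ τ in 𝓝 (h k), 0 ≤ τ → 0 ≤ g τ) ∧
      HasDerivAt g (n * volume.real (polyhedron u h) * α k * h k ^ (p - 1) - facetArea u h k)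
        (h k) := by
  obtain ⟨c, hc⟩ := H.exists_forall_inner_lt hunit
  have hp0 : p ≠ 0 := (one_pos.trans_le hp).ne'
  have hS := hasDerivAt_weightedPowerSum_update (α := α) (h := h) hp k
  have hS1 : weightedPowerSum α p (Function.update h k (h k)) = 1 := by
    rw [Function.update_eq_self, H.weightedPowerSum_eq_one]
  refine ⟨fun τ => volume.real (polyhedron u h) *
      weightedPowerSum α p (Function.update h k τ) ^ ((n : ℝ) / p) -
      volume.real (polyhedron u (Function.update h k τ)), ?_, ?_, ?_⟩
  · simp [H.weightedPowerSum_eq_one]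
  · have hev : ∀ᶠ τ in 𝓝 (h k), 0 < weightedPowerSum α p (Function.update h k τ) :=
      hS.continuousAt.eventually (lt_mem_nhds (by simp only [hS1]; exact one_pos))
    filter_upwards [hev] with τ hτ hτ0
    refine sub_nonneg.2 (H.le_of_nonneg _ (fun j => ?_) hτ)
    rcases eq_or_ne j k with rfl | hj
    · rwa [Function.update_self]
    · rw [Function.update_of_ne hj]
      exact H.nonneg j
  · have hd := ((hS.rpow_const (p := (n : ℝ) / p)
      (Or.inl (by rw [hS1]; exact one_ne_zero))).const_mul
      (volume.real (polyhedron u h))).sub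
      (hasDerivAt_measureReal_polyhedron_update hunit hinj hu hc k)
    refine hd.congr_deriv ?_
    rw [hS1, Real.one_rpow]
    field_simp

/-- The Euler–Lagrange equation for facets at positive distance from the origin. -/
theorem IsVolumeMaximizer.facetArea_eq (H : IsVolumeMaximizer u α p h) (hp : 1 ≤ p)
    (hunit : ∀ k, ‖u k‖ = 1) (hinj : Function.Injective u)
    (hu : ∀ x, x ≠ 0 → ∃ k, 0 < inner ℝ x (u k)) {k : ι} (hk : 0 < h k) :
    facetArea u h k = n * volume.real (polyhedron u h) * α k * h k ^ (p - 1) := by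
  obtain ⟨g, hg0, hg, hd⟩ := H.hasDerivAt_defect hp hunit hinj hu k
  have hmin : IsLocalMin g (h k) := by
    filter_upwards [hg, lt_mem_nhds hk] with τ hτ hτ0
    rw [hg0]
    exact hτ hτ0.le
  have := hmin.hasDerivAt_eq_zero hd
  linarith

/-- For `p > 1` the power sum does not change to first order when a vanishing coordinate is
increased, so the facets through the origin are degenerate. -/
theorem IsVolumeMaximizer.facetArea_eq_zero (H : IsVolumeMaximizer u α p h) (hp : 1 < p)
    (hunit : ∀ k, ‖u k‖ = 1) (hinj : Function.Injective u)
    (hu : ∀ x, x ≠ 0 → ∃ k, 0 < inner ℝ x (u k)) {k : ι} (hk : h k = 0) :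
    facetArea u h k = 0 := by
  obtain ⟨g, hg0, hg, hd⟩ := H.hasDerivAt_defect hp.le hunit hinj hu k
  rw [hk] at hg0 hg hd
  rw [Real.zero_rpow (sub_pos.2 hp).ne', mul_zero, zero_sub] at hd
  have hslope := (hasDerivAt_iff_tendsto_slope.1 hd).mono_left
    (nhdsWithin_mono (0 : ℝ) (fun x (hx : x ∈ Set.Ioi (0 : ℝ)) => ne_of_gt hx))
  have h0 : 0 ≤ -facetArea u h k := by
    refine ge_of_tendsto hslope ?_
    filter_upwards [self_mem_nhdsWithin, nhdsWithin_le_nhds hg] with τ hτ hgτ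
    have hτ : 0 < τ := hτ
    rw [slope_def_field, hg0, sub_zero, sub_zero]
    exact div_nonneg (hgτ hτ.le) hτ.le
  exact le_antisymm (neg_nonneg.1 h0) measureReal_nonneg

/-- Inequalities whose facets have no area can be dropped: otherwise, a point violating only such
inequalities, joined to an interior point, would cross one of these facets in its relative
interior. -/
theorem mem_polyhedron_of_facetArea_eq_zero (hunit : ∀ k, ‖u k‖ = 1)
    (hu : ∀ x, x ≠ 0 → ∃ k, 0 < inner ℝ x (u k))
    {c : EuclideanSpace ℝ (Fin n)} (hc : ∀ j, inner ℝ c (u j) < h j) (T : Finset ι)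
    (hT : ∀ k ∈ T, facetArea u h k = 0) {x : EuclideanSpace ℝ (Fin n)}
    (hx : ∀ j ∉ T, inner ℝ x (u j) ≤ h j) : x ∈ polyhedron u h := by
  classical
  induction T using Finset.induction_on generalizing x with
  | empty => exact fun j => hx j (Finset.notMem_empty j)
  | insert k T hkT ih =>
    have ih' := @ih fun j hj => hT j (Finset.mem_insert_of_mem hj)
    refine ih' fun j hj => ?_
    rcases ne_or_eq j k with hjk | rfl
    · exact hx j (by simp [hjk, hj])
    by_contra! hlt
    -- The point where the segment from `c` to `x` crosses the hyperplane of the `j`-th facet.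
    set a := inner ℝ c (u j) with ha
    set b := inner ℝ x (u j) with hb
    have hcj : a < h j := hc j
    have hab : 0 < b - a := by linarith
    set l := (h j - a) / (b - a) with hl
    have hl0 : 0 < l := div_pos (by linarith) hab
    have hl1 : l < 1 := (div_lt_one hab).2 (by linarith)
    have hz : ∀ i, inner ℝ (c + l • (x - c)) (u i) =
        (1 - l) * inner ℝ c (u i) + l * inner ℝ x (u i) := fun i => by
      rw [inner_add_left, real_inner_smul_left, inner_sub_left]
      ring
    have hpos : 0 < facetArea u h j := by
      refine facetArea_pos (hunit j) hu
        (U := {z | ∀ i : {i // i ∉ insert j T}, inner ℝ z (u i) < h i})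
        (isOpen_setOf_forall_inner_lt (fun i : {i // i ∉ insert j T} => u i) fun i => h i)
        ⟨c + l • (x - c), fun i => ?_, ?_⟩ ?_
      · rw [hz]
        calc _ < (1 - l) * h i + l * h i :=
              add_lt_add_of_lt_of_le (mul_lt_mul_of_pos_left (hc i) (sub_pos.2 hl1))
                (mul_le_mul_of_nonneg_left (hx i i.2) hl0.le)
          _ = h i := by ring
      · rw [Set.mem_ofPred_eq, hz, ← ha, ← hb, hl]
        field_simp
        ring
      · rintro z ⟨hzU, hzj⟩
        refine ih' fun i hi => ?_
        rcases eq_or_ne i j with rfl | hij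
        · exact le_of_eq hzj
        · exact (hzU ⟨i, by simp [hij, hi]⟩).le
    exact hpos.ne' (hT j (Finset.mem_insert_self j T))

/-- For `p > 1` the maximal polyhedron contains the origin in its interior. -/
theorem IsVolumeMaximizer.pos (H : IsVolumeMaximizer u α p h) (hp : 1 < p)
    (hunit : ∀ k, ‖u k‖ = 1) (hinj : Function.Injective u)
    (hu : ∀ x, x ≠ 0 → ∃ k, 0 < inner ℝ x (u k)) (k : ι) : 0 < h k := by
  classical
  by_contra! hk
  have hk : h k = 0 := le_antisymm hk (H.nonneg k)
  obtain ⟨c, hc⟩ := H.exists_forall_inner_lt hunit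
  -- A small negative multiple of `c` violates exactly the inequalities with `h j = 0`.
  have hev : ∀ j, ∀ᶠ t : ℝ in 𝓝[>] 0, h j ≠ 0 → inner ℝ ((-t) • c) (u j) ≤ h j := by
    intro j
    rcases eq_or_ne (h j) 0 with hj | hj
    · exact Eventually.of_forall fun t h' => (h' hj).elim
    · have hcont : Continuous fun t : ℝ => inner ℝ ((-t) • c) (u j) := by fun_prop
      have hlt : inner ℝ ((-(0 : ℝ)) • c) (u j) < h j := by
        simpa using lt_of_le_of_ne (H.nonneg j) hj.symm
      exact (((hcont.tendsto 0).eventually (gt_mem_nhds hlt)).filter_mono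
        nhdsWithin_le_nhds).mono fun t ht _ => ht.le
  obtain ⟨t, ht, ht0⟩ := ((eventually_all.2 hev).and self_mem_nhdsWithin).exists
  have ht0 : 0 < t := ht0
  have hmem := mem_polyhedron_of_facetArea_eq_zero hunit hu hc
    (Finset.univ.filter fun j => h j = 0)
    (fun j hj => H.facetArea_eq_zero hp hunit hinj hu (by simpa using hj))
    (x := (-t) • c) (fun j hj => ht j (by simpa using hj)) k
  have hck := hc k
  rw [hk] at hmem hck
  rw [real_inner_smul_left] at hmem
  nlinarith

/-- For `p = 1` and balanced weights, the variational problem is invariant under translations, so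
the maximal polyhedron can be moved to contain the origin in its interior. -/
theorem IsVolumeMaximizer.exists_pos_of_sum_smul_eq_zero (H : IsVolumeMaximizer u α 1 h)
    (hunit : ∀ k, ‖u k‖ = 1) (hbal : ∑ k, α k • u k = 0) :
    ∃ h', IsVolumeMaximizer u α 1 h' ∧ ∀ k, 0 < h' k := by
  obtain ⟨c, hc⟩ := H.exists_forall_inner_lt hunit
  have hpos : ∀ k, 0 < h k - inner ℝ c (u k) := fun k => sub_pos.2 (hc k)
  have hV : volume.real (polyhedron u fun k => h k - inner ℝ c (u k)) =
      volume.real (polyhedron u h) := by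
    rw [Measure.real, Measure.real, ← measure_preimage_add_right volume c (polyhedron u h)]
    congr 2
    ext x
    simp only [mem_polyhedron, Set.mem_preimage, inner_add_left, le_sub_iff_add_le]
  have hS : weightedPowerSum α 1 (fun k => h k - inner ℝ c (u k)) = 1 := by
    have h0 : ∑ k, α k * inner ℝ c (u k) = 0 := by
      simpa [inner_sum, real_inner_smul_right] using congrArg (fun z => inner ℝ c z) hbal
    have h1 := H.weightedPowerSum_eq_one
    simp only [weightedPowerSum, Real.rpow_one] at h1 ⊢
    simp only [mul_sub, Finset.sum_sub_distrib, h0, h1, sub_zero]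
  exact ⟨_, ⟨fun k => (hpos k).le, hS, by rw [hV]; exact H.volume_pos, by
    rw [hV]; exact H.le_of_nonneg⟩, hpos⟩

/-- The `L_p` Minkowski problem in terms of support numbers and facet areas. -/
theorem exists_pos_facetArea_mul_rpow_eq [Nonempty ι] (hp : 1 ≤ p) (hpn : p ≠ n)
    (hα : ∀ k, 0 < α k) (hunit : ∀ k, ‖u k‖ = 1) (hinj : Function.Injective u)
    (hu : ∀ x, x ≠ 0 → ∃ k, 0 < inner ℝ x (u k)) (hbal : p = 1 → ∑ k, α k • u k = 0) :
    ∃ h : ι → ℝ, (∀ k, 0 < h k) ∧ ∀ k, h k ^ (1 - p) * facetArea u h k = α k := by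
  obtain ⟨h, H, hpos⟩ : ∃ h, IsVolumeMaximizer u α p h ∧ ∀ k, 0 < h k := by
    obtain ⟨h, H⟩ := exists_isVolumeMaximizer hp hα hunit hu
    rcases hp.lt_or_eq with hp1 | rfl
    · exact ⟨h, H, H.pos hp1 hunit hinj hu⟩
    · exact H.exists_pos_of_sum_smul_eq_zero hunit (hbal rfl)
  have hn : 1 ≤ n := by
    by_contra! hn
    obtain rfl : n = 0 := by omega
    obtain ⟨k⟩ := ‹Nonempty ι›
    have := hunit k
    rw [Subsingleton.elim (u k) 0, norm_zero] at this
    exact zero_ne_one this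
  set m := (n : ℝ) * volume.real (polyhedron u h) with hm
  have hm0 : 0 < m := mul_pos (by exact_mod_cast hn) H.volume_pos
  have hnp : (n : ℝ) - p ≠ 0 := sub_ne_zero.2 hpn.symm
  -- Dilation by `s` multiplies `h k ^ (1 - p) * facetArea u h k` by `s ^ (n - p)`.
  set s := m⁻¹ ^ ((n : ℝ) - p)⁻¹ with hs
  have hs0 : 0 < s := Real.rpow_pos_of_pos (inv_pos.2 hm0) _
  have hsm : s ^ ((n : ℝ) - p) = m⁻¹ := Real.rpow_inv_rpow (inv_pos.2 hm0).le hnp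
  refine ⟨s • h, fun k => mul_pos hs0 (hpos k), fun k => ?_⟩
  have hs1 : s ^ (1 - p) * s ^ (n - 1) = m⁻¹ := by
    rw [← hsm, ← Real.rpow_natCast, ← Real.rpow_add hs0, Nat.cast_sub hn]
    congr 1
    push_cast
    ring
  have hh1 : h k ^ (1 - p) * h k ^ (p - 1) = 1 := by
    rw [← Real.rpow_add (hpos k)]
    simp
  rw [facetArea_smul hs0, H.facetArea_eq hp hunit hinj hu (hpos k), Pi.smul_apply, smul_eq_mul,
    Real.mul_rpow hs0.le (hpos k).le, ← hm]
  calc _ = (s ^ (1 - p) * s ^ (n - 1)) * m * α k * (h k ^ (1 - p) * h k ^ (p - 1)) := by ring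
    _ = α k := by rw [hs1, hh1, inv_mul_cancel₀ hm0.ne', one_mul, mul_one]

end Variational

/-! ### The surface area measure of a polyhedron -/

section SurfaceArea

variable {ι : Type*} {n : ℕ}

/-- The points of the polyhedron at which the `k`-th inequality is tight and all others are
strict, that is, the relative interior of the `k`-th facet. -/
def openFacet (u : ι → EuclideanSpace ℝ (Fin n)) (h : ι → ℝ) (k : ι) :
    Set (EuclideanSpace ℝ (Fin n)) :=
  {x | inner ℝ x (u k) = h k ∧ ∀ j, j ≠ k → inner ℝ x (u j) < h j}

theorem openFacet_subset_polyhedron (u : ι → EuclideanSpace ℝ (Fin n)) (h : ι → ℝ) (k : ι) :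
    openFacet u h k ⊆ polyhedron u h := fun x hx j => by
  rcases eq_or_ne j k with rfl | hj
  exacts [hx.1.le, (hx.2 j hj).le]

variable {u : ι → UnitSphere n} {h : ι → ℝ}

theorem isOuterNormal_of_inner_eq {x : EuclideanSpace ℝ (Fin n)} {k : ι}
    (hx : inner ℝ x (u k : EuclideanSpace ℝ (Fin n)) = h k) :
    IsOuterNormal (polyhedron (fun k => (u k).1) h) x (u k) :=
  fun y hy => by
    rw [hx]
    exact hy k

theorem mem_frontier_of_mem_openFacet {x : EuclideanSpace ℝ (Fin n)} {k : ι}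
    (hx : x ∈ openFacet (fun k => (u k).1) h k) :
    x ∈ frontier (polyhedron (fun k => (u k).1) h) := by
  refine ⟨subset_closure (openFacet_subset_polyhedron _ _ _ hx), fun hint => ?_⟩
  have hc : Continuous fun t : ℝ => x + t • (u k : EuclideanSpace ℝ (Fin n)) := by fun_prop
  have hev : ∀ᶠ t : ℝ in 𝓝[>] 0, x + t • (u k : EuclideanSpace ℝ (Fin n)) ∈
      polyhedron (fun k => (u k).1) h :=
    nhdsWithin_le_nhds (hc.continuousAt.eventually_mem
      (by simpa using mem_interior_iff_mem_nhds.1 hint))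
  obtain ⟨t, ht, ht0⟩ := (hev.and self_mem_nhdsWithin).exists
  have ht0 : 0 < t := ht0
  have := ht k
  rw [inner_add_left, real_inner_smul_left, hx.1, real_inner_self_eq_norm_sq] at this
  simp at this
  linarith

variable [Finite ι]

/-- Near a point of an open facet the polyhedron is a half-space, so the facet normal is the only
outer unit normal there. -/
theorem eq_of_isOuterNormal {x : EuclideanSpace ℝ (Fin n)} {k : ι}
    (hx : x ∈ openFacet (fun k => (u k).1) h k) {v : UnitSphere n}
    (hv : IsOuterNormal (polyhedron (fun k => (u k).1) h) x v) : v = u k := by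
  have hdir : ∀ z : EuclideanSpace ℝ (Fin n), inner ℝ z (u k : EuclideanSpace ℝ (Fin n)) ≤ 0 →
      inner ℝ z (v : EuclideanSpace ℝ (Fin n)) ≤ 0 := by
    intro z hz
    have hev : ∀ j, ∀ᶠ t : ℝ in 𝓝[>] 0,
        inner ℝ (x + t • z) (u j : EuclideanSpace ℝ (Fin n)) ≤ h j := by
      intro j
      rcases eq_or_ne j k with rfl | hj
      · filter_upwards [self_mem_nhdsWithin] with t ht
        have ht : 0 < t := ht
        rw [inner_add_left, real_inner_smul_left, hx.1]
        nlinarith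
      · have hc : Continuous fun t : ℝ =>
            inner ℝ (x + t • z) (u j : EuclideanSpace ℝ (Fin n)) := by fun_prop
        have hlt : inner ℝ (x + (0 : ℝ) • z) (u j : EuclideanSpace ℝ (Fin n)) < h j := by
          simpa using hx.2 j hj
        exact (((hc.tendsto 0).eventually (gt_mem_nhds hlt)).filter_mono
          nhdsWithin_le_nhds).mono fun t ht => ht.le
    obtain ⟨t, ht, ht0⟩ := ((eventually_all.2 hev).and self_mem_nhdsWithin).exists
    have ht0 : 0 < t := ht0
    have := hv _ ht
    rw [inner_add_left, real_inner_smul_left] at this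
    by_contra! hpos
    nlinarith [mul_pos ht0 hpos]
  have hunit : ∀ w : UnitSphere n, ‖(w : EuclideanSpace ℝ (Fin n))‖ = 1 := fun w => by simp
  -- Test with `z = v - ⟪v, u k⟫ u k`, orthogonal to `u k`, and with `z = - u k`.
  have h1 := hdir (v - (inner ℝ (v : EuclideanSpace ℝ (Fin n)) (u k)) • u k) (by
    rw [inner_sub_left, real_inner_smul_left, real_inner_self_eq_norm_sq, hunit]
    simp)
  have h2 := hdir (-(u k)) (by
    rw [inner_neg_left, real_inner_self_eq_norm_sq, hunit]
    norm_num)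
  rw [inner_sub_left, real_inner_smul_left, real_inner_self_eq_norm_sq, hunit,
    real_inner_comm (v : EuclideanSpace ℝ (Fin n)) (u k)] at h1
  rw [inner_neg_left] at h2
  rw [real_inner_comm] at h1
  have h3 : inner ℝ (u k : EuclideanSpace ℝ (Fin n)) (v : EuclideanSpace ℝ (Fin n)) = 1 := by
    have hle := real_inner_le_norm (u k : EuclideanSpace ℝ (Fin n)) v
    rw [hunit, hunit, one_mul] at hle
    nlinarith
  exact Subtype.ext ((inner_eq_one_iff_of_norm_eq_one (hunit _) (hunit _)).1 h3).symm

theorem mem_regularBoundary_polyhedron_iff (hinj : Function.Injective u)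
    {x : EuclideanSpace ℝ (Fin n)} :
    x ∈ regularBoundary (polyhedron (fun k => (u k).1) h) ↔
      ∃ k, x ∈ openFacet (fun k => (u k).1) h k := by
  constructor
  · rintro ⟨hx, v, hv, huniq⟩
    have hxP : x ∈ polyhedron (fun k => (u k).1) h := (isClosed_polyhedron _ _).frontier_subset hx
    obtain ⟨k, hk⟩ : ∃ k, inner ℝ x (u k : EuclideanSpace ℝ (Fin n)) = h k := by
      by_contra! hne
      exact hx.2 (mem_interior_polyhedron fun k => lt_of_le_of_ne (hxP k) (hne k))
    refine ⟨k, hk, fun j hj => lt_of_le_of_ne (hxP j) fun hjx => hj (hinj ?_)⟩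
    rw [huniq _ (isOuterNormal_of_inner_eq hjx), huniq _ (isOuterNormal_of_inner_eq hk)]
  · rintro ⟨k, hk⟩
    exact ⟨mem_frontier_of_mem_openFacet hk, u k, isOuterNormal_of_inner_eq hk.1,
      fun v hv => eq_of_isOuterNormal hk hv⟩

theorem gaussMap_eq_of_mem_openFacet {k : ι} (x : regularBoundary (polyhedron (fun k => (u k).1) h))
    (hx : (x : EuclideanSpace ℝ (Fin n)) ∈
      openFacet (fun k => (u k).1) h k) :
    gaussMap (polyhedron (fun k => (u k).1) h) x = u k :=
  eq_of_isOuterNormal hx (gaussMap_spec _ x)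

/-- The relative boundary of a facet does not contribute to its area. -/
theorem euclideanHausdorffMeasure_openFacet (hinj : Function.Injective u)
    (hu : ∀ x : EuclideanSpace ℝ (Fin n), x ≠ 0 →
      ∃ k, 0 < inner ℝ x (u k : EuclideanSpace ℝ (Fin n)))
    (hpos : ∀ k, 0 < h k) (k : ι) :
    (μHE[n - 1] : Measure (EuclideanSpace ℝ (Fin n)))
        (openFacet (fun k => (u k).1) h k) =
      ENNReal.ofReal (facetArea (fun k => (u k).1) h k) := by
  classical
  set w : ι → EuclideanSpace ℝ (Fin n) := fun k => u k with hw
  have hunit : ∀ k, ‖w k‖ = 1 := fun k => by simp [hw]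
  have hwinj : Function.Injective w := fun i j hij => hinj (Subtype.ext hij)
  have hset : {y : (ℝ ∙ w k)ᗮ | h k • w k + (y : EuclideanSpace ℝ (Fin n)) ∈
      openFacet w h k} =ᵐ[volume] polyhedron (sliceNormal w k) (sliceBound w h k (h k)) := by
    have hae : ∀ᵐ y : (ℝ ∙ w k)ᗮ, ∀ j,
        inner ℝ y (sliceNormal w k j) ≠ sliceBound w h k (h k) j := by
      rw [ae_all_iff]
      intro j
      by_cases hj : sliceNormal w k j = 0
      · refine Eventually.of_forall fun y => ?_
        rw [hj, inner_zero_right]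
        exact (sliceBound_ne_zero (c := 0) hunit hwinj (by simpa using hpos) j hj).symm
      · exact measure_eq_zero_iff_ae_notMem.1 (addHaar_hyperplane volume hj _)
    filter_upwards [hae] with y hy
    have hyk := inner_smul_add_coe_orthogonal (hunit k) (h k) y
    refine propext ⟨fun hyf => ?_, fun hyP => ⟨hyk, fun j hj => ?_⟩⟩
    · have h1 := setOf_mem_polyhedron_update (u := w) (h := h) (hunit k) (h k) (h k)
      rw [Function.update_eq_self, if_pos le_rfl] at h1
      rw [← h1]
      exact openFacet_subset_polyhedron w h k hyf
    · have h1 := lt_of_le_of_ne (hyP j) (hy j)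
      rw [inner_sliceNormal, sliceBound, if_neg hj] at h1
      rw [inner_add_left, real_inner_smul_left]
      linarith
  have hinter : openFacet w h k = openFacet w h k ∩ {x | inner ℝ x (w k) = h k} :=
    (Set.inter_eq_left.2 fun x hx => hx.1).symm
  rw [hinter, euclideanHausdorffMeasure_inter_hyperplane (hunit k), measure_congr hset,
    facetArea_eq_measureReal_slice (hunit k), Measure.real, ENNReal.ofReal_toReal]
  refine (isCompact_polyhedron (fun y hy => ?_) _).measure_lt_top.ne
  obtain ⟨j, hj⟩ := hu y (by simpa using hy)
  exact ⟨j, by rwa [inner_sliceNormal]⟩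

theorem measurableSet_openFacet (w : ι → EuclideanSpace ℝ (Fin n)) (k : ι) :
    MeasurableSet (openFacet w h k) := by
  have : openFacet w h k = {x | inner ℝ x (w k) = h k} ∩
      ⋂ j, {x | j ≠ k → inner ℝ x (w j) < h j} := by
    ext x
    simp [openFacet]
  rw [this]
  refine (isClosed_eq (by fun_prop) continuous_const).measurableSet.inter
    (MeasurableSet.iInter fun j => ?_)
  by_cases hj : j = k
  · simp [hj]
  · simpa [hj] using (isOpen_lt (by fun_prop) continuous_const).measurableSet

/-- The `L_p` surface area measure of a polyhedron containing the origin in its interior. -/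
theorem lpSurfaceAreaMeasure_polyhedron {ι : Type*} [Fintype ι] {u : ι → UnitSphere n} {h : ι → ℝ}
    (p : ℝ) (hinj : Function.Injective u)
    (hu : ∀ x : EuclideanSpace ℝ (Fin n), x ≠ 0 →
      ∃ k, 0 < inner ℝ x (u k : EuclideanSpace ℝ (Fin n)))
    (hpos : ∀ k, 0 < h k) :
    lpSurfaceAreaMeasure p (polyhedron (fun k => (u k).1) h) =
      ∑ k, ENNReal.ofReal (h k ^ (1 - p) *
        facetArea (fun k => (u k).1) h k) • Measure.dirac (u k) := by
  set w : ι → EuclideanSpace ℝ (Fin n) := fun k => u k with hw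
  set B := regularBoundary (polyhedron w h) with hB
  set G : ι → Set B := fun k => Subtype.val ⁻¹' openFacet w h k with hG
  have hGm : ∀ k, MeasurableSet (G k) := fun k =>
    (measurableSet_openFacet w k).preimage measurable_subtype_coe
  have hGdisj : Pairwise (Function.onFun Disjoint G) := fun i j hij =>
    Set.disjoint_left.2 fun x hxi hxj => (hxi.2 j hij.symm).ne hxj.1
  have hGuniv : ⋃ k, G k = Set.univ := by
    refine Set.eq_univ_of_forall fun x => Set.mem_iUnion.2 ?_
    exact (mem_regularBoundary_polyhedron_iff hinj).1 x.2
  have hGmeas : ∀ k, (μHE[n - 1] : Measure (EuclideanSpace ℝ (Fin n))).comap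
      (Subtype.val : B → EuclideanSpace ℝ (Fin n)) (G k) =
      ENNReal.ofReal (facetArea w h k) := fun k => by
    rw [comap_hausdorff_apply, Subtype.image_preimage_coe, Set.inter_eq_right.2,
      euclideanHausdorffMeasure_openFacet hinj hu hpos]
    exact fun x hx => (mem_regularBoundary_polyhedron_iff hinj).2 ⟨k, hx⟩
  ext ω hω
  have hωm : MeasurableSet (gaussMap (polyhedron w h) ⁻¹' ω) :=
    (continuous_gaussMap _).measurable hω
  rw [lpSurfaceAreaMeasure_apply p _ hω, ← lintegral_indicator hωm, ← setLIntegral_univ, ← hGuniv,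
    lintegral_iUnion hGm hGdisj, tsum_fintype, Measure.finsetSum_apply]
  refine Finset.sum_congr rfl fun k _ => ?_
  rw [Measure.smul_apply, Measure.dirac_apply' _ hω, smul_eq_mul]
  -- On the `k`-th open facet the integrand is constant.
  have hconst : ∀ x ∈ G k, (gaussMap (polyhedron w h) ⁻¹' ω).indicator (fun x : B =>
      ENNReal.ofReal ((inner ℝ (x : EuclideanSpace ℝ (Fin n))
        (gaussMap (polyhedron w h) x : EuclideanSpace ℝ (Fin n))) ^ (1 - p))) x =
      ENNReal.ofReal (h k ^ (1 - p)) * ω.indicator 1 (u k) := by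
    intro x hx
    have hg : gaussMap (polyhedron w h) x = u k := gaussMap_eq_of_mem_openFacet x hx
    have hxk : inner ℝ (x : EuclideanSpace ℝ (Fin n)) (u k : EuclideanSpace ℝ (Fin n)) = h k :=
      hx.1
    by_cases hk : u k ∈ ω
    · rw [Set.indicator_of_mem (by rwa [Set.mem_preimage, hg]), hg, hxk,
        Set.indicator_of_mem hk, Pi.one_apply, mul_one]
    · rw [Set.indicator_of_notMem (by rwa [Set.mem_preimage, hg]), Set.indicator_of_notMem hk,
        mul_zero]
  rw [setLIntegral_congr_fun (hGm k) hconst, setLIntegral_const, hGmeas,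
    ENNReal.ofReal_mul (Real.rpow_nonneg (hpos k).le _)]
  ring

theorem isPolytope_polyhedron {u : ι → EuclideanSpace ℝ (Fin n)}
    (hu : ∀ x, x ≠ 0 → ∃ k, 0 < inner ℝ x (u k)) (hpos : ∀ k, 0 < h k) :
    IsPolytope (polyhedron u h) ∧ 0 ∈ interior (polyhedron u h) := by
  have h0 : (0 : EuclideanSpace ℝ (Fin n)) ∈ interior (polyhedron u h) :=
    mem_interior_polyhedron (by simpa using hpos)
  exact ⟨⟨exists_finset_polyhedron_eq_convexHull hu h,
    Measure.measure_pos_of_nonempty_interior volume ⟨0, h0⟩⟩, h0⟩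

end SurfaceArea
end LpMinkowski

/-! ### The existence theorem -/

theorem mainTheorem2 (n N : ℕ) (hN : n + 1 ≤ N) (p : ℝ) (hp : 1 ≤ p) (hpn : p ≠ (n : ℝ))
    (α : Fin N → ℝ) (hα : ∀ k, 0 < α k)
    (u : Fin N → LpMinkowski.UnitSphere n)
    (hu : ¬ ∃ w : LpMinkowski.UnitSphere n, ∀ k, u k ∈ LpMinkowski.closedHemisphere w)
    (hcentroid : p = 1 → ∑ k, α k • (u k : EuclideanSpace ℝ (Fin n)) = 0) :
    ∃ P₀ : Set (EuclideanSpace ℝ (Fin n)),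
      LpMinkowski.IsPolytope P₀ ∧ 0 ∈ interior P₀ ∧
      LpMinkowski.lpSurfaceAreaMeasure p P₀ =
        ∑ k, ENNReal.ofReal (α k) • Measure.dirac (u k) := by
  classical
  -- Coinciding normals are merged and their weights added up.
  let v : Finset.univ.image u → LpMinkowski.UnitSphere n := Subtype.val
  let β : Finset.univ.image u → ℝ := fun x => ∑ k ∈ Finset.univ.filter (fun k => u k = x), α k
  have hvinj : Function.Injective v := Subtype.val_injective
  have hfib : ∀ {M : Type} [AddCommMonoid M] (f : Fin N → M),
      ∑ k, f k = ∑ x : Finset.univ.image u, ∑ k ∈ Finset.univ.filter (fun k => u k = x), f k := by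
    intro M _ f
    rw [← Finset.sum_fiberwise_of_maps_to (t := Finset.univ.image u) (g := u)
      fun k _ => Finset.mem_image_of_mem u (Finset.mem_univ k)]
    exact (Finset.sum_coe_sort (Finset.univ.image u)
      fun x => ∑ k ∈ Finset.univ.filter (fun k => u k = x), f k).symm
  have hβ : ∀ x, 0 < β x := fun x => by
    obtain ⟨k, -, hk⟩ := Finset.mem_image.1 x.2
    exact Finset.sum_pos (fun k _ => hα k) ⟨k, by simpa using hk⟩
  have hne : Nonempty (Finset.univ.image u) :=
    ⟨⟨u ⟨0, by omega⟩, Finset.mem_image_of_mem u (Finset.mem_univ _)⟩⟩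
  have hspan : ∀ x : EuclideanSpace ℝ (Fin n), x ≠ 0 →
      ∃ k, 0 < inner ℝ x (v k : EuclideanSpace ℝ (Fin n)) := by
    intro x hx
    by_contra! hle
    refine hu ⟨⟨-(‖x‖⁻¹ • x), by simp [norm_smul, hx]⟩, fun k => ?_⟩
    have h1 := hle ⟨u k, Finset.mem_image_of_mem u (Finset.mem_univ k)⟩
    have h2 : inner ℝ (u k : EuclideanSpace ℝ (Fin n)) x ≤ 0 := by
      rw [real_inner_comm]
      exact h1
    simp only [LpMinkowski.closedHemisphere, Set.mem_ofPred_eq, inner_neg_right,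
      real_inner_smul_right]
    exact neg_nonneg.2 (mul_nonpos_of_nonneg_of_nonpos (by positivity) h2)
  have hbal : p = 1 → ∑ x, β x • (v x : EuclideanSpace ℝ (Fin n)) = 0 := by
    intro hp1
    refine Eq.trans ?_ (hcentroid hp1)
    rw [hfib]
    refine Finset.sum_congr rfl fun x _ => ?_
    rw [Finset.sum_smul]
    exact Finset.sum_congr rfl fun k hk => by rw [(Finset.mem_filter.1 hk).2]
  obtain ⟨h, hpos, hh⟩ := LpMinkowski.exists_pos_facetArea_mul_rpow_eq hp hpn hβ
    (fun k => by simp) (fun i j hij => hvinj (Subtype.ext hij)) hspan hbal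
  obtain ⟨hpoly, hint⟩ := LpMinkowski.isPolytope_polyhedron hspan hpos
  refine ⟨_, hpoly, hint, ?_⟩
  rw [LpMinkowski.lpSurfaceAreaMeasure_polyhedron p hvinj hspan hpos, hfib]
  refine Finset.sum_congr rfl fun x _ => ?_
  rw [hh, ENNReal.ofReal_sum_of_nonneg fun k _ => (hα k).le, Finset.sum_smul]
  exact Finset.sum_congr rfl fun k hk => by rw [(Finset.mem_filter.1 hk).2]
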